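/- Let $L\ge 3$ and $d_1,\dots,d_L\ge 3$ be integers. Then there is a finite set of pairwise orthogonal unit vectors in $\bigotimes_{i=1}^{L}\mathbb{C}^{d_i}$, each of which is fully product (of the form $v_1\otimes\cdots\otimes v_L$ with $v_i\in\mathbb{C}^{d_i}$), that is genuinely nonlocal: for every partition of the $L$ parties into two nonempty groups $A$ and $B$, the states of the set, regarded as bipartite states in $\bigl(\bigotimes_{i\in A}\mathbb{C}^{d_i}\bigr)\otimes\bigl(\bigotimes_{i\in B}\mathbb{C}^{d_i}\bigr)$, cannot be perfectly distinguished by LOCC between $A$ and $B$. Here an LOCC protocol consists of finitely many rounds; in each round one of the two groups applies a quantum instrument with finitely many classical outcomes to its own finite-dimensional system (whose dimension may change) and announces the outcome to the other group, and all later steps may depend on all announced outcomes. The states are perfectly distinguished by a protocol if, on input of any state of the set, the protocol names that state with probability one. -/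

import Mathlib

open scoped Matrix Kronecker

namespace GenuineNonlocality

/-- The joint space `⨂ i, ℂ^(d i)` of `L` parties, in coordinates with respect to the product basis
`|x 1⟩ ⊗ ⋯ ⊗ |x L⟩`, `x i ∈ Fin (d i)`, with its standard inner product. -/
abbrev StateSpace {L : ℕ} (d : Fin L → ℕ) : Type :=
  EuclideanSpace ℂ ((i : Fin L) → Fin (d i))

/-- `ψ = v 1 ⊗ v 2 ⊗ ⋯ ⊗ v L`. -/
def IsFullyProduct {L : ℕ} {d : Fin L → ℕ} (ψ : StateSpace d) : Prop :=
  ∃ v : (i : Fin L) → EuclideanSpace ℂ (Fin (d i)), ∀ x, ψ x = ∏ i, v i (x i)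

/-- `IsLOCC E` : the operator-valued measure `E` with outcomes in `Ω`, acting on `ℂ^α ⊗ ℂ^β`, is
implemented by a finite LOCC protocol between Alice (who holds `ℂ^α`) and Bob (who holds `ℂ^β`).

* `done ω`: the protocol ends, with outcome `ω`.
* `alice`: Alice applies a quantum instrument to her system. Its classical outcome `o` is announced
  to Bob; given `o`, her system is mapped to `ℂ^(α' o)` by the completely positive map with Kraus
  operators `K o s` (`s` is not announced). The two parties then continue with an LOCC protocol on
  `ℂ^(α' o) ⊗ ℂ^β` which may depend on `o` and implements `F o`.
* `bob`: the same with the roles exchanged. -/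
inductive IsLOCC {Ω : Type} [DecidableEq Ω] :
    ∀ {α β : Type} [Fintype α] [DecidableEq α] [Fintype β] [DecidableEq β],
      (Ω → Matrix (α × β) (α × β) ℂ) → Prop
  | done {α β : Type} [Fintype α] [DecidableEq α] [Fintype β] [DecidableEq β] (ω : Ω) :
      IsLOCC (fun ω' => if ω' = ω then (1 : Matrix (α × β) (α × β) ℂ) else 0)
  | alice {α β : Type} [Fintype α] [DecidableEq α] [Fintype β] [DecidableEq β]
      {O S : Type} [Fintype O] [Fintype S]
      {α' : O → Type} [∀ o, Fintype (α' o)] [∀ o, DecidableEq (α' o)]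
      (K : (o : O) → S → Matrix (α' o) α ℂ)
      (complete : ∑ o, ∑ s, (K o s)ᴴ * K o s = 1)
      (F : (o : O) → Ω → Matrix (α' o × β) (α' o × β) ℂ)
      (next : ∀ o, IsLOCC (F o)) :
      IsLOCC (fun ω => ∑ o, ∑ s,
        (K o s ⊗ₖ (1 : Matrix β β ℂ))ᴴ * F o ω * (K o s ⊗ₖ (1 : Matrix β β ℂ)))
  | bob {α β : Type} [Fintype α] [DecidableEq α] [Fintype β] [DecidableEq β]
      {O S : Type} [Fintype O] [Fintype S]
      {β' : O → Type} [∀ o, Fintype (β' o)] [∀ o, DecidableEq (β' o)]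
      (K : (o : O) → S → Matrix (β' o) β ℂ)
      (complete : ∑ o, ∑ s, (K o s)ᴴ * K o s = 1)
      (F : (o : O) → Ω → Matrix (α × β' o) (α × β' o) ℂ)
      (next : ∀ o, IsLOCC (F o)) :
      IsLOCC (fun ω => ∑ o, ∑ s,
        ((1 : Matrix α α ℂ) ⊗ₖ K o s)ᴴ * F o ω * ((1 : Matrix α α ℂ) ⊗ₖ K o s))

/-- The bipartite states `φ k ∈ ℂ^α ⊗ ℂ^β` (unit vectors) are perfectly distinguishable by LOCC:
some LOCC protocol outputs, on input `φ k`, the label `k` with probability one. (The extra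
outcome `none` means that no label is named; so an empty family is distinguishable.) -/
def LocallyDistinguishable {κ α β : Type} [DecidableEq κ] [Fintype α] [DecidableEq α]
    [Fintype β] [DecidableEq β] (φ : κ → α × β → ℂ) : Prop :=
  ∃ E : Option κ → Matrix (α × β) (α × β) ℂ,
    IsLOCC E ∧ ∀ k, star (φ k) ⬝ᵥ (E (some k) *ᵥ φ k) = 1

/-- An `L`-partite state regarded as a bipartite state, the first system consisting of the parties
in `A` and the second one of all the others. -/
def acrossCut {L : ℕ} {d : Fin L → ℕ} (A : Finset (Fin L)) (ψ : StateSpace d) :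
    ((i : {i : Fin L // i ∈ A}) → Fin (d i)) × ((i : {i : Fin L // i ∉ A}) → Fin (d i)) → ℂ :=
  fun p => ψ ((Equiv.piEquivPiSubtypeProd (fun i => i ∈ A) (fun i => Fin (d i))).symm p)

/-- Local indistinguishability across every bipartition `A | Aᶜ` of the parties into two nonempty
groups. -/
def GenuinelyNonlocal {L : ℕ} {d : Fin L → ℕ} {κ : Type} [DecidableEq κ]
    (ψ : κ → StateSpace d) : Prop :=
  ∀ A : Finset (Fin L), A.Nonempty → Aᶜ.Nonempty →
    ¬ LocallyDistinguishable (fun k => acrossCut A (ψ k))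

end GenuineNonlocality

namespace GenuineNonlocality

open scoped ComplexOrder

/-! ### Finite LOCC protocols -/

/-! The set consists of the two states `(|p⟩ ± |q⟩) / √2` on each of a family of disjoint pairs `{p,
q}` (dominoes) of product basis vectors. The words of `p` and `q` differ at one party only, so the
states are fully product, and disjointness makes them orthonormal. Every cut separates some party `k
+ 1` from all of `0, …, k` (`exists_separated_party`). In the grid of that party, one side of the
cut sees only the row and the other only the column, and four of the dominoes form a pinwheel there
(`word_dominoCode_pinwheelIndex`).

It suffices that the eight states on one pinwheel are indistinguishable. If `M ⊗ 1` or `1 ⊗ M` keeps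
them orthogonal, then `M` is scalar (`pinwheel_left_trivial`, `pinwheel_right_trivial`). In a
perfect protocol every Kraus operator must keep the states orthogonal, so on the span of the grid it
is a multiple of an isometry. By induction (`IsLOCC.not_annihilates`) some branch of nonzero weight
still carries an isometric copy of all eight states when the protocol ends, and a single outcome
cannot name them all. -/

theorem IsLOCC.posSemidef {Ω : Type} [DecidableEq Ω] {α β : Type} [Fintype α] [DecidableEq α]
    [Fintype β] [DecidableEq β] {E : Ω → Matrix (α × β) (α × β) ℂ} (h : IsLOCC E) (ω : Ω) :
    (E ω).PosSemidef := by
  induction h with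
  | done ω' =>
    dsimp only
    split_ifs
    exacts [Matrix.PosSemidef.one, Matrix.PosSemidef.zero]
  | alice K complete F next ih =>
    exact Matrix.posSemidef_sum _ fun o _ => Matrix.posSemidef_sum _ fun s _ =>
      (ih o).conjTranspose_mul_mul_same _
  | bob K complete F next ih =>
    exact Matrix.posSemidef_sum _ fun o _ => Matrix.posSemidef_sum _ fun s _ =>
      (ih o).conjTranspose_mul_mul_same _

theorem IsLOCC.sum_eq_one {Ω : Type} [DecidableEq Ω] [Fintype Ω] {α β : Type} [Fintype α]
    [DecidableEq α] [Fintype β] [DecidableEq β] {E : Ω → Matrix (α × β) (α × β) ℂ}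
    (h : IsLOCC E) : ∑ ω, E ω = 1 := by
  induction h with
  | done ω' => simp
  | alice K complete F next ih =>
    simp_rw [Finset.sum_comm (s := (Finset.univ : Finset Ω)), ← Matrix.sum_mul, ← Matrix.mul_sum,
      ih, Matrix.mul_one, Matrix.conjTranspose_kronecker, ← Matrix.mul_kronecker_mul]
    ext ⟨i, i'⟩ ⟨j, j'⟩
    have := congrFun (congrFun complete i) j
    simp only [Matrix.sum_apply] at this
    simp [Matrix.sum_apply, Matrix.kroneckerMap_apply, this, Matrix.one_apply, Prod.ext_iff,
      ite_and]
    split_ifs <;> rfl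
  | bob K complete F next ih =>
    simp_rw [Finset.sum_comm (s := (Finset.univ : Finset Ω)), ← Matrix.sum_mul, ← Matrix.mul_sum,
      ih, Matrix.mul_one, Matrix.conjTranspose_kronecker, ← Matrix.mul_kronecker_mul]
    ext ⟨i, i'⟩ ⟨j, j'⟩
    have := congrFun (congrFun complete i') j'
    simp only [Matrix.sum_apply] at this
    simp [Matrix.sum_apply, Matrix.kroneckerMap_apply, this, Matrix.one_apply, Prod.ext_iff,
      ite_and]

theorem mulVec_eq_zero_of_sum_mulVec_eq_zero {ι n : Type*} [Fintype ι] [Fintype n]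
    {A : ι → Matrix n n ℂ} (hA : ∀ i, (A i).PosSemidef) {x : n → ℂ}
    (hx : star x ⬝ᵥ ((∑ i, A i) *ᵥ x) = 0) (i : ι) : A i *ᵥ x = 0 := by
  rw [← (hA i).dotProduct_mulVec_zero_iff]
  rw [Matrix.sum_mulVec, dotProduct_sum, Finset.sum_eq_zero_iff_of_nonneg] at hx
  · exact hx i (Finset.mem_univ i)
  · exact fun j _ => (hA j).dotProduct_mulVec_nonneg x

/-- A term of a sum of conjugates `Kᴴ F K` of positive semidefinite matrices that annihilates a
vector `x` has `F` annihilating `K x`. -/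
theorem mulVec_mulVec_eq_zero_of_sum_conj {O S m : Type*} [Fintype O] [Fintype S] [Fintype m]
    {n : O → Type*} [∀ o, Fintype (n o)] {K : (o : O) → S → Matrix (n o) m ℂ}
    {F : (o : O) → Matrix (n o) (n o) ℂ} (hF : ∀ o, (F o).PosSemidef) {x : m → ℂ}
    (hx : (∑ o, ∑ s, (K o s)ᴴ * F o * K o s) *ᵥ x = 0) (o : O) (s : S) :
    F o *ᵥ (K o s *ᵥ x) = 0 := by
  have hpos (o : O) (s : S) : ((K o s)ᴴ * F o * K o s).PosSemidef :=
    (hF o).conjTranspose_mul_mul_same _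
  have h1 := mulVec_eq_zero_of_sum_mulVec_eq_zero
    (fun o => Matrix.posSemidef_sum Finset.univ fun s _ => hpos o s) (x := x) (by simp [hx]) o
  have h2 := mulVec_eq_zero_of_sum_mulVec_eq_zero (hpos o) (x := x) (by simp [h1]) s
  rw [← (hF o).dotProduct_mulVec_zero_iff, Matrix.star_mulVec, ← Matrix.dotProduct_mulVec,
    Matrix.mulVec_mulVec, Matrix.mulVec_mulVec, h2, dotProduct_zero]

/-- Vectors which are named with certainty by a resolution of the identity are orthogonal. -/
theorem dotProduct_eq_zero_of_annihilates {J Ω n : Type*} [Fintype Ω] [Fintype n]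
    [DecidableEq n] {E : Ω → Matrix n n ℂ} (hE : ∀ ω, (E ω).PosSemidef) (h1 : ∑ ω, E ω = 1)
    {f : J → Ω} (hf : f.Injective) {x : J → n → ℂ}
    (hx : ∀ j ω, ω ≠ f j → E ω *ᵥ x j = 0) {j l : J} (hjl : j ≠ l) :
    star (x j) ⬝ᵥ x l = 0 := by
  -- Insert `1 = ∑ ω, E ω`: each `ω` differs from `f j` or from `f l`, so each `E ω` annihilates one
  -- of the two vectors.
  rw [← Matrix.one_mulVec (x l), ← h1, Matrix.sum_mulVec, dotProduct_sum]
  refine Finset.sum_eq_zero fun ω _ => ?_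
  by_cases h : ω = f l
  · have := hx j ω (by rw [h]; exact fun e => hjl (hf e.symm))
    rw [Matrix.dotProduct_mulVec, ← (hE ω).isHermitian.eq, ← Matrix.star_mulVec, this, star_zero,
      zero_dotProduct]
  · rw [hx l ω h, dotProduct_zero]

/-- If neither party can apply a nontrivial measurement operator that keeps the states `φ j`
orthogonal, then no finite LOCC protocol distinguishes them, nor their images under scaled local
isometries `V ⊗ W`. -/
theorem IsLOCC.not_annihilates {J Ω α₀ β₀ : Type} [DecidableEq Ω] [Fintype Ω]
    [Fintype α₀] [DecidableEq α₀] [Fintype β₀] [DecidableEq β₀] [Nonempty α₀] [Nonempty β₀]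
    {φ : J → α₀ × β₀ → ℂ}
    (hA : ∀ M : Matrix α₀ α₀ ℂ, (∀ j l, j ≠ l →
      star (φ j) ⬝ᵥ ((M ⊗ₖ (1 : Matrix β₀ β₀ ℂ)) *ᵥ φ l) = 0) → ∃ c : ℂ, M = c • 1)
    (hB : ∀ M : Matrix β₀ β₀ ℂ, (∀ j l, j ≠ l →
      star (φ j) ⬝ᵥ (((1 : Matrix α₀ α₀ ℂ) ⊗ₖ M) *ᵥ φ l) = 0) → ∃ c : ℂ, M = c • 1)
    (hφ : ∀ j, φ j ≠ 0) {j₀ j₁ : J} (hj : j₀ ≠ j₁) {f : J → Ω} (hf : f.Injective)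
    {α β : Type} [Fintype α] [DecidableEq α] [Fintype β] [DecidableEq β]
    {E : Ω → Matrix (α × β) (α × β) ℂ} (h : IsLOCC E) :
    ∀ (V : Matrix α α₀ ℂ) (W : Matrix β β₀ ℂ) (a b : ℂ), a ≠ 0 → b ≠ 0 →
      Vᴴ * V = a • 1 → Wᴴ * W = b • 1 →
      ¬ ∀ j ω, ω ≠ f j → E ω *ᵥ ((V ⊗ₖ W) *ᵥ φ j) = 0 := by
  induction h with
  | @done α β _ _ _ _ ω' =>
    intro V W a b ha hb hV hW hE
    -- The constant answer `ω'` misnames one of the states. There the identity would annihilate `(V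
    -- ⊗ W) φ j`, which a nonzero multiple of an isometry forbids.
    obtain ⟨j, hj⟩ : ∃ j, ω' ≠ f j := by
      by_contra! hc
      exact hj (hf ((hc j₀).symm.trans (hc j₁)))
    have h0 := hE j ω' hj
    simp only [if_true, Matrix.one_mulVec] at h0
    have h1 := congrArg ((V ⊗ₖ W)ᴴ *ᵥ ·) h0
    simp only [Matrix.mulVec_mulVec, Matrix.conjTranspose_kronecker, ← Matrix.mul_kronecker_mul,
      hV, hW, Matrix.smul_kronecker, Matrix.kronecker_smul, Matrix.one_kronecker_one, smul_smul,
      Matrix.smul_mulVec, Matrix.one_mulVec, Matrix.mulVec_zero, smul_eq_zero, mul_eq_zero] at h1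
    rcases h1 with (h1 | h1) | h1
    exacts [hb h1, ha h1, hφ j h1]
  | @alice α β _ _ _ _ O S _ _ α' _ _ K complete F next ih =>
    intro V W a b ha hb hV hW hE
    have hF (o : O) (s : S) (j : J) (ω : Ω) (hω : ω ≠ f j) :
        F o ω *ᵥ (((K o s * V) ⊗ₖ W) *ᵥ φ j) = 0 := by
      have := mulVec_mulVec_eq_zero_of_sum_conj (fun o => (next o).posSemidef ω) (hE j ω hω) o s
      rwa [Matrix.mulVec_mulVec _ _ (V ⊗ₖ W), ← Matrix.mul_kronecker_mul, Matrix.one_mul] at this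
    -- The rest of the protocol names the states after `K o s` with certainty, so they are
    -- orthogonal. Bob's factor contributes only the scalar `b ≠ 0`, and `hA` applies to Alice's.
    have hc (o : O) (s : S) : ∃ c : ℂ, (K o s * V)ᴴ * (K o s * V) = c • 1 := by
      refine hA _ fun j l hjl => ?_
      have h0 := dotProduct_eq_zero_of_annihilates (fun ω => (next o).posSemidef ω)
        (next o).sum_eq_one hf (hF o s) hjl
      rw [Matrix.star_mulVec, ← Matrix.dotProduct_mulVec, Matrix.mulVec_mulVec,
        Matrix.conjTranspose_kronecker, ← Matrix.mul_kronecker_mul, hW, Matrix.kronecker_smul,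
        Matrix.smul_mulVec, dotProduct_smul, smul_eq_zero] at h0
      exact h0.resolve_left hb
    choose c hc using hc
    -- Completeness distributes the weight `a ≠ 0` over the branches, so some branch keeps a nonzero
    -- weight.
    have hsum : ∑ o, ∑ s, c o s = a := by
      have : (∑ o, ∑ s, c o s) • (1 : Matrix α₀ α₀ ℂ) = a • 1 := by
        have h1 : Vᴴ * (∑ o, ∑ s, (K o s)ᴴ * K o s) * V = Vᴴ * V := by
          rw [complete, Matrix.mul_one]
        simp_rw [Finset.sum_smul, ← hc, ← hV, ← h1, Matrix.conjTranspose_mul, Matrix.mul_sum,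
          Matrix.sum_mul, Matrix.mul_assoc]
      have := congrFun (congrFun this (Classical.arbitrary α₀)) (Classical.arbitrary α₀)
      simpa using this
    obtain ⟨o, s, hne⟩ : ∃ o s, c o s ≠ 0 := by
      by_contra! h0
      exact ha (by simp [← hsum, h0])
    exact ih o (K o s * V) W _ b hne hb (hc o s) hW (hF o s)
  | @bob α β _ _ _ _ O S _ _ α' _ _ K complete F next ih =>
    intro V W a b ha hb hV hW hE
    have hF (o : O) (s : S) (j : J) (ω : Ω) (hω : ω ≠ f j) :
        F o ω *ᵥ ((V ⊗ₖ (K o s * W)) *ᵥ φ j) = 0 := by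
      have := mulVec_mulVec_eq_zero_of_sum_conj (fun o => (next o).posSemidef ω) (hE j ω hω) o s
      rwa [Matrix.mulVec_mulVec _ _ (V ⊗ₖ W), ← Matrix.mul_kronecker_mul, Matrix.one_mul] at this
    have hc (o : O) (s : S) : ∃ c : ℂ, (K o s * W)ᴴ * (K o s * W) = c • 1 := by
      refine hB _ fun j l hjl => ?_
      have h0 := dotProduct_eq_zero_of_annihilates (fun ω => (next o).posSemidef ω)
        (next o).sum_eq_one hf (hF o s) hjl
      rw [Matrix.star_mulVec, ← Matrix.dotProduct_mulVec, Matrix.mulVec_mulVec,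
        Matrix.conjTranspose_kronecker, ← Matrix.mul_kronecker_mul, hV, Matrix.smul_kronecker,
        Matrix.smul_mulVec, dotProduct_smul, smul_eq_zero] at h0
      exact h0.resolve_left ha
    choose c hc using hc
    have hsum : ∑ o, ∑ s, c o s = b := by
      have : (∑ o, ∑ s, c o s) • (1 : Matrix β₀ β₀ ℂ) = b • 1 := by
        have h1 : Wᴴ * (∑ o, ∑ s, (K o s)ᴴ * K o s) * W = Wᴴ * W := by
          rw [complete, Matrix.mul_one]
        simp_rw [Finset.sum_smul, ← hc, ← hW, ← h1, Matrix.conjTranspose_mul, Matrix.mul_sum,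
          Matrix.sum_mul, Matrix.mul_assoc]
      have := congrFun (congrFun this (Classical.arbitrary β₀)) (Classical.arbitrary β₀)
      simpa using this
    obtain ⟨o, s, hne⟩ : ∃ o s, c o s ≠ 0 := by
      by_contra! h0
      exact hb (by simp [← hsum, h0])
    exact ih o V (K o s * W) a _ ha hne hV (hc o s) (hF o s)

/-- A family of bipartite unit vectors containing the images of the `φ j` under local isometries
`V ⊗ W` is not distinguishable by LOCC, if no party can measure the `φ j` nontrivially while
keeping them orthogonal. -/
theorem not_locallyDistinguishable {J κ α₀ β₀ : Type} [DecidableEq κ] [Fintype κ]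
    [Fintype α₀] [DecidableEq α₀] [Fintype β₀] [DecidableEq β₀] [Nonempty α₀] [Nonempty β₀]
    {φ : J → α₀ × β₀ → ℂ}
    (hA : ∀ M : Matrix α₀ α₀ ℂ, (∀ j l, j ≠ l →
      star (φ j) ⬝ᵥ ((M ⊗ₖ (1 : Matrix β₀ β₀ ℂ)) *ᵥ φ l) = 0) → ∃ c : ℂ, M = c • 1)
    (hB : ∀ M : Matrix β₀ β₀ ℂ, (∀ j l, j ≠ l →
      star (φ j) ⬝ᵥ (((1 : Matrix α₀ α₀ ℂ) ⊗ₖ M) *ᵥ φ l) = 0) → ∃ c : ℂ, M = c • 1)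
    (hφ : ∀ j, star (φ j) ⬝ᵥ φ j = 1) {j₀ j₁ : J} (hj : j₀ ≠ j₁) {g : J → κ}
    (hg : g.Injective) {α β : Type} [Fintype α] [DecidableEq α] [Fintype β] [DecidableEq β]
    {χ : κ → α × β → ℂ} {V : Matrix α α₀ ℂ} {W : Matrix β β₀ ℂ}
    (hV : Vᴴ * V = 1) (hW : Wᴴ * W = 1) (hχ : ∀ j, χ (g j) = (V ⊗ₖ W) *ᵥ φ j) :
    ¬ LocallyDistinguishable χ := by
  rintro ⟨E, hE, h⟩
  refine hE.not_annihilates hA hB (fun j h0 => by simpa [h0] using hφ j) hj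
    ((Option.some_injective κ).comp hg) V W 1 1 one_ne_zero one_ne_zero (by simpa using hV)
    (by simpa using hW) fun j ω hω => ?_
  have hnorm : star (χ (g j)) ⬝ᵥ χ (g j) = 1 := by
    rw [hχ, Matrix.star_mulVec, ← Matrix.dotProduct_mulVec, Matrix.mulVec_mulVec,
      Matrix.conjTranspose_kronecker, ← Matrix.mul_kronecker_mul, hV, hW,
      Matrix.one_kronecker_one, Matrix.one_mulVec, hφ]
  rw [← hχ]
  have hsum : star (χ (g j)) ⬝ᵥ
      ((∑ ω : {ω // ω ≠ some (g j)}, E ω) *ᵥ χ (g j)) = 0 := by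
    have h1 := hE.sum_eq_one
    rw [Fintype.sum_eq_add_sum_subtype_ne _ (some (g j))] at h1
    rw [eq_sub_of_add_eq' h1, Matrix.sub_mulVec, dotProduct_sub, h, Matrix.one_mulVec, hnorm, sub_self]
  exact mulVec_eq_zero_of_sum_mulVec_eq_zero (fun ω => hE.posSemidef _) hsum ⟨ω, hω⟩

/-! ### Domino states -/

/-- The relative sign of the two basis vectors in a domino state. -/
def sign : Bool → ℂ
  | false => 1
  | true => -1

/-- The two states `(|p⟩ ± |q⟩) / √2` on each of the dominoes `{p, q} = {u t false, u t true}`. -/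
noncomputable def dominoState {T ι : Type*} [DecidableEq ι] (u : T → Bool → ι) (j : T × Bool) :
    ι → ℂ :=
  (√2 : ℂ)⁻¹ • (Pi.single (u j.1 false) 1 + sign j.2 • Pi.single (u j.1 true) 1)

theorem inv_sqrt_two_mul_self : ((√2 : ℝ) : ℂ)⁻¹ * ((√2 : ℝ) : ℂ)⁻¹ = 1 / 2 := by
  rw [← mul_inv, ← Complex.ofReal_mul, Real.mul_self_sqrt zero_le_two]
  norm_num

theorem star_sign (s : Bool) : star (sign s) = sign s := by cases s <;> simp [sign]

theorem star_dominoState {T ι : Type*} [DecidableEq ι] (u : T → Bool → ι) (j : T × Bool) :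
    star (dominoState u j) = dominoState u j := by
  have h (i : ι) : star (Pi.single i 1 : ι → ℂ) = Pi.single i 1 := by
    rw [← Pi.single_star, star_one]
  simp only [dominoState, star_smul, star_add, h, star_sign, star_inv₀]
  simp

theorem dominoState_dotProduct_mulVec {T ι : Type*} [Fintype ι] [DecidableEq ι]
    (u : T → Bool → ι) (B : Matrix ι ι ℂ) (j l : T × Bool) :
    star (dominoState u j) ⬝ᵥ (B *ᵥ dominoState u l) =
      1 / 2 * (B (u j.1 false) (u l.1 false) + sign l.2 * B (u j.1 false) (u l.1 true) +
        sign j.2 * (B (u j.1 true) (u l.1 false) + sign l.2 * B (u j.1 true) (u l.1 true))) := by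
  rw [star_dominoState, ← inv_sqrt_two_mul_self]
  simp only [dominoState, Matrix.mulVec_smul, Matrix.mulVec_add, Matrix.mulVec_single_one,
    smul_dotProduct, dotProduct_smul, add_dotProduct, dotProduct_add, single_one_dotProduct,
    Matrix.col_apply, smul_eq_mul]
  ring

theorem star_dominoState_dotProduct {T ι : Type*} [DecidableEq T] [Fintype ι] [DecidableEq ι]
    {u : T → Bool → ι} (hu : (Function.uncurry u).Injective) (j l : T × Bool) :
    star (dominoState u j) ⬝ᵥ dominoState u l = if j = l then 1 else 0 := by
  have key (t t' : T) (b b' : Bool) : u t b = u t' b' ↔ t = t' ∧ b = b' := by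
    simpa [Function.uncurry] using hu.eq_iff (a := (t, b)) (b := (t', b'))
  rw [← Matrix.one_mulVec (dominoState u l), dominoState_dotProduct_mulVec]
  obtain ⟨t, s⟩ := j
  obtain ⟨t', s'⟩ := l
  simp only [Matrix.one_apply, key, Prod.mk.injEq]
  by_cases h : t = t' <;> cases s <;> cases s' <;> simp [h, sign] <;> norm_num

/-! ### Operators that keep domino states orthogonal -/

section Orthogonality

variable {T ι : Type*} [Fintype ι] [DecidableEq ι] {u : T → Bool → ι} {B : Matrix ι ι ℂ}

/-- For two different dominoes the four choices of signs give four linear equations in the four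
entries of `B` between them, with an invertible matrix of signs. -/
theorem apply_eq_zero_of_orthogonal
    (h : ∀ j l, j ≠ l → star (dominoState u j) ⬝ᵥ (B *ᵥ dominoState u l) = 0) {t t' : T}
    (ht : t ≠ t') (b b' : Bool) : B (u t b) (u t' b') = 0 := by
  have h' (s s' : Bool) := h (t, s) (t', s') fun e => ht (Prod.ext_iff.1 e).1
  simp only [dominoState_dotProduct_mulVec] at h'
  have h1 := h' false false
  have h2 := h' false true
  have h3 := h' true false
  have h4 := h' true true
  simp only [sign] at h1 h2 h3 h4
  cases b <;> cases b'
  · linear_combination (h1 + h2 + h3 + h4) / 2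
  · linear_combination (h1 - h2 + h3 - h4) / 2
  · linear_combination (h1 + h2 - h3 - h4) / 2
  · linear_combination (h1 - h2 - h3 + h4) / 2

theorem apply_self_eq_of_orthogonal
    (h : ∀ j l, j ≠ l → star (dominoState u j) ⬝ᵥ (B *ᵥ dominoState u l) = 0) (t : T) :
    B (u t false) (u t false) = B (u t true) (u t true) := by
  have h1 := h (t, false) (t, true) (by simp)
  have h2 := h (t, true) (t, false) (by simp)
  simp only [dominoState_dotProduct_mulVec, sign] at h1 h2
  linear_combination h1 + h2

end Orthogonality

/-- The four dominoes around the centre of the `3 × 3` board. -/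
def pinwheel : Fin 4 → Bool → Fin 3 × Fin 3
  | 0, false => (0, 0)
  | 0, true => (0, 1)
  | 1, false => (0, 2)
  | 1, true => (1, 2)
  | 2, false => (2, 2)
  | 2, true => (2, 1)
  | 3, false => (1, 0)
  | 3, true => (2, 0)

theorem pinwheel_injective : (Function.uncurry pinwheel).Injective := by decide

/-- Two cells in one column, in rows `a ≠ b` and in different dominoes, give `M a b = 0`; the column
must be shared because the second factor is `1`. The two vertical dominoes equate the diagonal
entries. -/
theorem pinwheel_left_trivial (M : Matrix (Fin 3) (Fin 3) ℂ)
    (h : ∀ j l, j ≠ l → star (dominoState pinwheel j) ⬝ᵥ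
      ((M ⊗ₖ (1 : Matrix (Fin 3) (Fin 3) ℂ)) *ᵥ dominoState pinwheel l) = 0) :
    ∃ c : ℂ, M = c • 1 := by
  have h01 := apply_eq_zero_of_orthogonal h (show (0 : Fin 4) ≠ 3 by decide) false false
  have h10 := apply_eq_zero_of_orthogonal h (show (3 : Fin 4) ≠ 0 by decide) false false
  have h02 := apply_eq_zero_of_orthogonal h (show (0 : Fin 4) ≠ 3 by decide) false true
  have h20 := apply_eq_zero_of_orthogonal h (show (3 : Fin 4) ≠ 0 by decide) true false
  have h12 := apply_eq_zero_of_orthogonal h (show (1 : Fin 4) ≠ 2 by decide) true false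
  have h21 := apply_eq_zero_of_orthogonal h (show (2 : Fin 4) ≠ 1 by decide) false true
  have d01 := apply_self_eq_of_orthogonal h 1
  have d12 := apply_self_eq_of_orthogonal h 3
  simp only [pinwheel, Matrix.kroneckerMap_apply, Matrix.one_apply_eq, mul_one] at *
  refine ⟨M 0 0, ?_⟩
  ext i j
  fin_cases i <;> fin_cases j <;> simp [*]

theorem pinwheel_right_trivial (M : Matrix (Fin 3) (Fin 3) ℂ)
    (h : ∀ j l, j ≠ l → star (dominoState pinwheel j) ⬝ᵥ
      (((1 : Matrix (Fin 3) (Fin 3) ℂ) ⊗ₖ M) *ᵥ dominoState pinwheel l) = 0) :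
    ∃ c : ℂ, M = c • 1 := by
  have h01 := apply_eq_zero_of_orthogonal h (show (3 : Fin 4) ≠ 2 by decide) true true
  have h10 := apply_eq_zero_of_orthogonal h (show (2 : Fin 4) ≠ 3 by decide) true true
  have h02 := apply_eq_zero_of_orthogonal h (show (0 : Fin 4) ≠ 1 by decide) false false
  have h20 := apply_eq_zero_of_orthogonal h (show (1 : Fin 4) ≠ 0 by decide) false false
  have h12 := apply_eq_zero_of_orthogonal h (show (0 : Fin 4) ≠ 1 by decide) true false
  have h21 := apply_eq_zero_of_orthogonal h (show (1 : Fin 4) ≠ 0 by decide) false true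
  have d01 := apply_self_eq_of_orthogonal h 0
  have d12 := apply_self_eq_of_orthogonal h 2
  simp only [pinwheel, Matrix.kroneckerMap_apply, Matrix.one_apply_eq, one_mul] at *
  refine ⟨M 0 0, ?_⟩
  ext i j
  fin_cases i <;> fin_cases j <;> simp [*]

/-- The isometry that sends the basis vectors `|0⟩, |1⟩, …` to `|r 0⟩, |r 1⟩, …`. -/
def basisEmbedding {m α : Type*} [DecidableEq α] (r : m → α) : Matrix α m ℂ :=
  Matrix.of fun x i => if x = r i then 1 else 0

theorem basisEmbedding_isometry {m α : Type*} [DecidableEq m] [Fintype α] [DecidableEq α]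
    {r : m → α} (hr : r.Injective) : (basisEmbedding r)ᴴ * basisEmbedding r = 1 := by
  ext i j
  simp [basisEmbedding, Matrix.mul_apply, Matrix.one_apply, hr.eq_iff, eq_comm]

theorem basisEmbedding_kronecker_mulVec_dominoState {T m n α β : Type*} [Fintype m]
    [DecidableEq m] [Fintype n] [DecidableEq n] [DecidableEq α] [DecidableEq β]
    (r : m → α) (c : n → β) (u : T → Bool → m × n) (j : T × Bool) :
    (basisEmbedding r ⊗ₖ basisEmbedding c) *ᵥ dominoState u j =
      dominoState (fun t b => Prod.map r c (u t b)) j := by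
  have h (p : m × n) : (basisEmbedding r ⊗ₖ basisEmbedding c).col p =
      Pi.single (Prod.map r c p) 1 := by
    ext ⟨x, y⟩
    simp only [Matrix.col_apply, Matrix.kroneckerMap_apply, basisEmbedding, Matrix.of_apply,
      Pi.single_apply, Prod.ext_iff, Prod.map_fst, Prod.map_snd]
    split_ifs <;> simp_all
  simp only [dominoState, Matrix.mulVec_smul, Matrix.mulVec_add, Matrix.mulVec_single_one, h]

/-- A family of bipartite states that contains the states on a pinwheel of dominoes in some
`3 × 3` grid of basis vectors is not distinguishable by LOCC. -/
theorem not_locallyDistinguishable_of_pinwheel {κ α β : Type} [DecidableEq κ] [Fintype κ]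
    [Fintype α] [DecidableEq α] [Fintype β] [DecidableEq β] {χ : κ → α × β → ℂ}
    {r : Fin 3 → α} {c : Fin 3 → β} (hr : r.Injective) (hc : c.Injective)
    {g : Fin 4 × Bool → κ} (hg : g.Injective)
    (hχ : ∀ j, χ (g j) = dominoState (fun t b => Prod.map r c (pinwheel t b)) j) :
    ¬ LocallyDistinguishable χ :=
  not_locallyDistinguishable pinwheel_left_trivial pinwheel_right_trivial
    (fun j => by rw [star_dominoState_dotProduct pinwheel_injective, if_pos rfl])
    (show ((0, false) : Fin 4 × Bool) ≠ (1, false) by decide) hg (basisEmbedding_isometry hr)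
    (basisEmbedding_isometry hc)
    fun j => by rw [hχ, basisEmbedding_kronecker_mulVec_dominoState]

theorem dominoState_comp_equiv {T ι ι' : Type*} [DecidableEq ι] [DecidableEq ι']
    (u : T → Bool → ι) (e : ι ≃ ι') (j : T × Bool) :
    dominoState u j ∘ e.symm = dominoState (fun t b => e (u t b)) j := by
  ext x
  simp only [dominoState, Function.comp_apply, Pi.smul_apply, Pi.add_apply, Pi.single_apply,
    Equiv.symm_apply_eq]

/-- Swapping the two systems turns the pinwheel around. -/
theorem pinwheel_left_trivial_swap (M : Matrix (Fin 3) (Fin 3) ℂ)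
    (h : ∀ j l, j ≠ l → star (dominoState (fun t b => (pinwheel t b).swap) j) ⬝ᵥ
      ((M ⊗ₖ (1 : Matrix (Fin 3) (Fin 3) ℂ)) *ᵥ
        dominoState (fun t b => (pinwheel t b).swap) l) = 0) :
    ∃ c : ℂ, M = c • 1 :=
  pinwheel_right_trivial M fun j l hjl => by
    have := h j l hjl
    rw [dominoState_dotProduct_mulVec] at this ⊢
    simpa [Matrix.one_apply, mul_comm] using this

theorem pinwheel_right_trivial_swap (M : Matrix (Fin 3) (Fin 3) ℂ)
    (h : ∀ j l, j ≠ l → star (dominoState (fun t b => (pinwheel t b).swap) j) ⬝ᵥ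
      (((1 : Matrix (Fin 3) (Fin 3) ℂ) ⊗ₖ M) *ᵥ
        dominoState (fun t b => (pinwheel t b).swap) l) = 0) :
    ∃ c : ℂ, M = c • 1 :=
  pinwheel_left_trivial M fun j l hjl => by
    have := h j l hjl
    rw [dominoState_dotProduct_mulVec] at this ⊢
    simpa [Matrix.one_apply, mul_comm] using this

theorem not_locallyDistinguishable_of_pinwheel_swap {κ α β : Type} [DecidableEq κ] [Fintype κ]
    [Fintype α] [DecidableEq α] [Fintype β] [DecidableEq β] {χ : κ → α × β → ℂ}
    {r : Fin 3 → α} {c : Fin 3 → β} (hr : r.Injective) (hc : c.Injective)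
    {g : Fin 4 × Bool → κ} (hg : g.Injective)
    (hχ : ∀ j, χ (g j) = dominoState (fun t b => Prod.map r c (pinwheel t b).swap) j) :
    ¬ LocallyDistinguishable χ :=
  not_locallyDistinguishable pinwheel_left_trivial_swap pinwheel_right_trivial_swap
    (fun j => by
      rw [star_dominoState_dotProduct, if_pos rfl]
      exact Prod.swap_injective.comp pinwheel_injective)
    (show ((0, false) : Fin 4 × Bool) ≠ (1, false) by decide) hg (basisEmbedding_isometry hr)
    (basisEmbedding_isometry hc)
    fun j => by rw [hχ, basisEmbedding_kronecker_mulVec_dominoState]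

/-! ### Domino states of several parties -/

/-- The common letters factor out, and the superposition is carried by party `k` alone. -/
theorem isFullyProduct_dominoState {L : ℕ} {d : Fin L → ℕ} {T : Type*}
    {u : T → Bool → (i : Fin L) → Fin (d i)} {j : T × Bool} {k : Fin L}
    (h : ∀ i, i ≠ k → u j.1 false i = u j.1 true i) :
    IsFullyProduct (WithLp.toLp 2 (dominoState u j) : StateSpace d) := by
  refine ⟨fun i => WithLp.toLp 2 (if i = k then
    (√2 : ℂ)⁻¹ • (Pi.single (u j.1 false i) 1 + sign j.2 • Pi.single (u j.1 true i) 1)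
    else Pi.single (u j.1 false i) 1), fun x => ?_⟩
  rw [← Finset.mul_prod_erase _ _ (Finset.mem_univ k)]
  have h1 (p : (i : Fin L) → Fin (d i)) : x = p ↔ x k = p k ∧ ∀ i, i ≠ k → x i = p i :=
    ⟨fun e => by simp [e], fun e => funext fun i => by
      by_cases hi : i = k
      · rw [hi, e.1]
      · exact e.2 i hi⟩
  have h2 : ∏ i ∈ Finset.univ.erase k, (WithLp.toLp 2 (if i = k then
      (√2 : ℂ)⁻¹ • (Pi.single (u j.1 false i) 1 + sign j.2 • Pi.single (u j.1 true i) 1)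
      else Pi.single (u j.1 false i) 1) : EuclideanSpace ℂ (Fin (d i))) (x i) =
      if ∀ i, i ≠ k → x i = u j.1 false i then 1 else 0 := by
    rw [Finset.prod_congr rfl (g := fun i => if x i = u j.1 false i then (1 : ℂ) else 0)]
    · simp [Finset.prod_boole]
    · intro i hi
      simp [Finset.ne_of_mem_erase hi, Pi.single_apply]
  rw [h2]
  simp only [dominoState, Pi.smul_apply, Pi.add_apply, Pi.single_apply, smul_eq_mul, if_true]
  have h3 : (∀ i, i ≠ k → x i = u j.1 true i) ↔ ∀ i, i ≠ k → x i = u j.1 false i :=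
    forall₂_congr fun i hi => by rw [h i hi]
  simp only [h1, h3]
  by_cases h4 : ∀ i, i ≠ k → x i = u j.1 false i
  · simp only [and_iff_left h4, if_pos h4, mul_one]
  · simp only [h4, and_false, if_false, mul_zero, add_zero]

theorem orthonormal_dominoState {T ι : Type*} [DecidableEq T] [Fintype ι] [DecidableEq ι]
    {u : T → Bool → ι} (hu : (Function.uncurry u).Injective) :
    Orthonormal ℂ fun j => (WithLp.toLp 2 (dominoState u j) : EuclideanSpace ℂ ι) := by
  rw [orthonormal_iff_ite]
  intro j l
  rw [EuclideanSpace.inner_eq_star_dotProduct, dotProduct_comm]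
  exact star_dominoState_dotProduct hu j l

theorem acrossCut_dominoState {L : ℕ} {d : Fin L → ℕ} {T : Type*} (A : Finset (Fin L))
    (u : T → Bool → (i : Fin L) → Fin (d i)) (j : T × Bool) :
    acrossCut A (WithLp.toLp 2 (dominoState u j) : StateSpace d) =
      dominoState (fun t b => Equiv.piEquivPiSubtypeProd (fun i => i ∈ A) (fun i => Fin (d i))
        (u t b)) j :=
  dominoState_comp_equiv u (Equiv.piEquivPiSubtypeProd (fun i => i ∈ A) (fun i => Fin (d i))) j

/-! ### The dominoes

Basis vectors are labelled by words in the letters `0`, `1`, `2` padded by zeros. For each party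
`k + 1` there is a `3 × 3` grid, with rows given by the letter of party `k + 1` and columns by
three words for the parties `0, …, k`; one domino of the pinwheel in it already belongs to the grid
of party `k`. -/

/-- The word `2 ⋯ 2 a b c 0 0 ⋯` with `m` leading letters `2`, for `w = (m, a, b, c)`. -/
def word (w : ℕ × ℕ × ℕ × ℕ) (i : ℕ) : ℕ :=
  if i < w.1 then 2 else if i = w.1 then w.2.1 else if i = w.1 + 1 then w.2.2.1
  else if i = w.1 + 2 then w.2.2.2 else 0

theorem word_mk (m a b c i : ℕ) : word (m, a, b, c) i =
    if i < m then 2 else if i = m then a else if i = m + 1 then b else if i = m + 2 then c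
    else 0 := rfl

/-- The first letter other than `2` locates `m`, and the next letters give the remaining data. -/
theorem word_injOn : Set.InjOn word {w | w.2.1 ≠ 2} := by
  rintro ⟨m, a, b, c⟩ ha ⟨m', a', b', c'⟩ ha' h
  change a ≠ 2 at ha
  change a' ≠ 2 at ha'
  have h (i : ℕ) := congrFun h i
  simp only [word_mk] at h
  obtain rfl : m = m' := by
    have h1 := h m
    have h2 := h m'
    rcases lt_trichotomy m m' with hm | hm | hm
    · simp [hm, ha] at h1
    · exact hm
    · simp [hm, ha'.symm] at h2
  have h0 := h m
  have h1 := h (m + 1)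
  have h2 := h (m + 2)
  simp_all

/-- The words of the two basis vectors in the dominoes; the dominoes `1` and `2` exist only at
positive levels. -/
def dominoCode : ℕ → Fin 3 → Bool → ℕ × ℕ × ℕ × ℕ
  | 0, _, false => (0, 0, 0, 0)
  | 0, _, true => (1, 0, 0, 0)
  | k + 1, 0, false => (k, 1, 2, 0)
  | k + 1, 0, true => (k + 2, 0, 0, 0)
  | k + 1, 1, false => (k, 1, 0, 0)
  | k + 1, 1, true => (k, 1, 1, 0)
  | 1, 2, false => (0, 0, 1, 0)
  | 1, 2, true => (0, 0, 2, 0)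
  | k + 2, 2, false => (k, 1, 2, 1)
  | k + 2, 2, true => (k, 1, 2, 2)

theorem dominoCode_ne_two (k : ℕ) (c : Fin 3) (b : Bool) : (dominoCode k c b).2.1 ≠ 2 := by
  rcases k with _ | _ | k <;> fin_cases c <;> cases b <;> simp [dominoCode]

/-- Level `0` has a single domino and `dominoCode` ignores `c` there, hence the conditions `hk` and
`hk'`. -/
theorem dominoCode_injective {k k' : ℕ} {c c' : Fin 3} {b b' : Bool} (hk : k = 0 → c = 0)
    (hk' : k' = 0 → c' = 0) (h : dominoCode k c b = dominoCode k' c' b') :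
    k = k' ∧ c = c' ∧ b = b' := by
  rcases k with _ | _ | k <;> rcases k' with _ | _ | k' <;> fin_cases c <;> fin_cases c' <;>
    cases b <;> cases b' <;> simp_all [dominoCode]

theorem word_dominoCode_le_two (k : ℕ) (c : Fin 3) (b : Bool) (i : ℕ) :
    word (dominoCode k c b) i ≤ 2 := by
  rcases k with _ | _ | k <;> fin_cases c <;> cases b <;> simp only [dominoCode, word_mk] <;>
    split_ifs <;> omega

theorem word_dominoCode_eq_zero {k : ℕ} (c : Fin 3) (b : Bool) {i : ℕ} (hi : k < i) :
    word (dominoCode k c b) i = 0 := by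
  rcases k with _ | _ | k <;> fin_cases c <;> cases b <;> simp only [dominoCode, word_mk] <;>
    split_ifs <;> omega

theorem word_dominoCode_false_eq_true (k : ℕ) (c : Fin 3) :
    ∃ j ≤ k, ∀ i, i ≠ j → word (dominoCode k c false) i = word (dominoCode k c true) i := by
  rcases k with _ | _ | k <;> fin_cases c <;> simp only [dominoCode, word_mk]
  · exact ⟨0, by omega, fun i hi => by split_ifs <;> omega⟩
  · exact ⟨0, by omega, fun i hi => by split_ifs <;> omega⟩
  · exact ⟨0, by omega, fun i hi => by split_ifs <;> omega⟩
  · exact ⟨0, by omega, fun i hi => by split_ifs <;> omega⟩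
  · exact ⟨1, by omega, fun i hi => by split_ifs <;> omega⟩
  · exact ⟨1, by omega, fun i hi => by split_ifs <;> omega⟩
  · exact ⟨k + 1, by omega, fun i hi => by split_ifs <;> omega⟩
  · exact ⟨k + 2, by omega, fun i hi => by split_ifs <;> omega⟩
  · exact ⟨k + 2, by omega, fun i hi => by split_ifs <;> omega⟩

/-- The word in row `z` and column `y` of the grid of party `k + 1`. -/
def gridWord (k : ℕ) (z y : Fin 3) (i : ℕ) : ℕ :=
  if i ≤ k then
    match y with
    | 0 => if k = 0 then 0 else if i + 1 = k then 1 else 2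
    | 1 => 2
    | 2 => if i = k then 1 else 2
  else if i = k + 1 then z else 0

theorem gridWord_of_lt {k : ℕ} (z : Fin 3) (y y' : Fin 3) {i : ℕ} (hi : k < i) :
    gridWord k z y i = gridWord k z y' i := by
  simp [gridWord, hi.not_ge]

theorem gridWord_of_ne {k : ℕ} (z z' : Fin 3) (y : Fin 3) {i : ℕ} (hi : i ≠ k + 1) :
    gridWord k z y i = gridWord k z' y i := by
  simp [gridWord, hi]

theorem gridWord_row (k : ℕ) (z y : Fin 3) : gridWord k z y (k + 1) = z := by
  simp [gridWord]

theorem gridWord_column_injective {k : ℕ} {z y y' : Fin 3}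
    (h : ∀ i ≤ k, gridWord k z y i = gridWord k z y' i) : y = y' := by
  have h0 := h k le_rfl
  -- The letters at `k` and `k - 1` tell the columns apart. For `k = 0` both are letter `0`, which
  -- then takes the values `0, 2, 1`.
  have h1 := h (k - 1) (Nat.sub_le k 1)
  rcases k with _ | k <;> fin_cases y <;> fin_cases y' <;> simp_all [gridWord]

/-- Level and number of the dominoes in the pinwheel of party `k + 1`. -/
def pinwheelIndex (k : ℕ) : Fin 4 → ℕ × Fin 3
  | 0 => (k, 0)
  | 1 => (k + 1, 1)
  | 2 => (k + 1, 0)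
  | 3 => (k + 1, 2)

theorem pinwheelIndex_injective (k : ℕ) : (pinwheelIndex k).Injective := by
  intro t t' h
  fin_cases t <;> fin_cases t' <;> simp_all [pinwheelIndex]

theorem pinwheelIndex_le (k : ℕ) (t : Fin 4) : (pinwheelIndex k t).1 ≤ k + 1 := by
  fin_cases t <;> simp [pinwheelIndex]

theorem pinwheelIndex_eq_zero {k : ℕ} {t : Fin 4} (h : (pinwheelIndex k t).1 = 0) :
    (pinwheelIndex k t).2 = 0 := by
  fin_cases t <;> simp_all [pinwheelIndex]

/-- The grids form a chain: domino `2` of one pinwheel is domino `0` of the next. Columns `0, 1` and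
columns `1, 2` differ at one party each, as horizontal dominoes require; columns `0, 2` are never
joined. -/
theorem word_dominoCode_pinwheelIndex (k : ℕ) (t : Fin 4) (b : Bool) :
    word (dominoCode (pinwheelIndex k t).1 (pinwheelIndex k t).2 b) =
      gridWord k (pinwheel t b).1 (pinwheel t b).2 := by
  ext i
  rcases k with _ | k <;> fin_cases t <;> cases b <;>
    simp only [pinwheelIndex, pinwheel, dominoCode, word_mk, gridWord] <;> split_ifs <;>
    first | rfl | omega

/-! ### The set of states -/

section Parties

variable {L : ℕ} {d : Fin L → ℕ} (hd : ∀ i, 3 ≤ d i)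

/-- The label of a basis vector with the given letters. -/
def wordLabel (w : ℕ → ℕ) (i : Fin L) : Fin (d i) :=
  ⟨min (w i) 2, (min_le_right _ _).trans_lt (hd i)⟩

/-- The truncation at `2` only secures a valid label; it loses nothing on letters at most `2`. -/
theorem wordLabel_eq_iff {w w' : ℕ → ℕ} (hw : ∀ i, w i ≤ 2) (hw' : ∀ i, w' i ≤ 2) (i : Fin L) :
    wordLabel hd w i = wordLabel hd w' i ↔ w i = w' i := by
  simp [wordLabel, hw, hw']

/-- The index set of the dominoes. -/
abbrev DominoIndex (L : ℕ) : Type := {p : Fin L × Fin 3 // p.1.val = 0 → p.2 = 0}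

/-- The basis vectors in the dominoes. -/
def domino (t : DominoIndex L) (b : Bool) : (i : Fin L) → Fin (d i) :=
  wordLabel hd (word (dominoCode t.1.1 t.1.2 b))

theorem domino_injective : (Function.uncurry (domino hd)).Injective := by
  rintro ⟨⟨⟨k, c⟩, hk⟩, b⟩ ⟨⟨⟨k', c'⟩, hk'⟩, b'⟩ h
  have hw : word (dominoCode k c b) = word (dominoCode k' c' b') := by
    ext i
    by_cases hi : i < L
    · exact (wordLabel_eq_iff hd (word_dominoCode_le_two _ _ _) (word_dominoCode_le_two _ _ _)
        ⟨i, hi⟩).1 (congrFun h ⟨i, hi⟩)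
    -- Beyond the last party both words are zero padding.
    · rw [word_dominoCode_eq_zero _ _ (k.2.trans_le (not_lt.1 hi)),
        word_dominoCode_eq_zero _ _ (k'.2.trans_le (not_lt.1 hi))]
  obtain ⟨h1, rfl, rfl⟩ := dominoCode_injective hk hk'
    (word_injOn (dominoCode_ne_two _ _ _) (dominoCode_ne_two _ _ _) hw)
  obtain rfl := Fin.ext h1
  rfl

theorem isFullyProduct_domino (j : DominoIndex L × Bool) :
    IsFullyProduct (WithLp.toLp 2 (dominoState (domino hd) j) : StateSpace d) := by
  obtain ⟨m, hm, h⟩ := word_dominoCode_false_eq_true j.1.1.1 j.1.1.2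
  refine isFullyProduct_dominoState (k := ⟨m, hm.trans_lt j.1.1.1.2⟩) fun i hi => ?_
  simp only [domino, wordLabel, h i fun e => hi (Fin.ext e)]

/-- The dominoes of the pinwheel of party `k + 1`. -/
def pinwheelDomino {k : ℕ} (hk : k + 1 < L) (t : Fin 4) : DominoIndex L :=
  ⟨(⟨(pinwheelIndex k t).1, (pinwheelIndex_le k t).trans_lt hk⟩, (pinwheelIndex k t).2),
    pinwheelIndex_eq_zero⟩

theorem pinwheelDomino_injective {k : ℕ} (hk : k + 1 < L) :
    (pinwheelDomino hk).Injective := by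
  intro t t' h
  simp only [pinwheelDomino, Subtype.mk.injEq, Prod.mk.injEq, Fin.mk.injEq] at h
  exact pinwheelIndex_injective k (Prod.ext h.1 h.2)

theorem domino_pinwheelDomino {k : ℕ} (hk : k + 1 < L) (t : Fin 4) (b : Bool) :
    domino hd (pinwheelDomino hk t) b =
      wordLabel hd (gridWord k (pinwheel t b).1 (pinwheel t b).2) := by
  rw [← word_dominoCode_pinwheelIndex]
  rfl

theorem gridWord_le_two (k : ℕ) (z y : Fin 3) (i : ℕ) : gridWord k z y i ≤ 2 := by
  fin_cases y <;> simp only [gridWord] <;> split_ifs <;> omega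

/-- The restriction of a word to the parties satisfying `p`. -/
def groupLabel (p : Fin L → Prop) (w : ℕ → ℕ) (i : {i : Fin L // p i}) : Fin (d i) :=
  wordLabel hd w i

theorem groupLabel_row_injective {p : Fin L → Prop} {k : ℕ} (hk : k + 1 < L)
    (hp : p ⟨k + 1, hk⟩) (y : Fin 3) :
    (fun z : Fin 3 => groupLabel hd p (gridWord k z y)).Injective := by
  intro z z' h
  have := (wordLabel_eq_iff hd (gridWord_le_two _ _ _) (gridWord_le_two _ _ _) _).1
    (congrFun h ⟨⟨k + 1, hk⟩, hp⟩)
  exact Fin.ext (by simpa [gridWord_row] using this)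

theorem groupLabel_column_injective {p : Fin L → Prop} {k : ℕ} (hk : k + 1 < L)
    (hp : ∀ i : Fin L, i.val ≤ k → p i) (z : Fin 3) :
    (fun y : Fin 3 => groupLabel hd p (gridWord k z y)).Injective := by
  intro y y' h
  refine gridWord_column_injective (k := k) (z := z) fun i hi => ?_
  have hiL : i < L := by omega
  exact (wordLabel_eq_iff hd (gridWord_le_two _ _ _) (gridWord_le_two _ _ _) ⟨i, hiL⟩).1
    (congrFun h ⟨⟨i, hiL⟩, hp ⟨i, hiL⟩ hi⟩)

theorem groupLabel_eq_row {p : Fin L → Prop} {k : ℕ} (hp : ∀ i : Fin L, i.val ≤ k → ¬ p i)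
    (z y y' : Fin 3) :
    groupLabel hd p (gridWord k z y) = groupLabel hd p (gridWord k z y') := by
  ext i
  have hi : k < i.1.val := not_le.1 fun h => hp i.1 h i.2
  simp only [groupLabel, wordLabel, gridWord_of_lt z y y' hi]

theorem groupLabel_eq_column {p : Fin L → Prop} {k : ℕ} (hk : k + 1 < L)
    (hp : ¬ p ⟨k + 1, hk⟩) (z z' y : Fin 3) :
    groupLabel hd p (gridWord k z y) = groupLabel hd p (gridWord k z' y) := by
  ext i
  have hi : i.1.val ≠ k + 1 := fun h => hp (by
    have : i.1 = ⟨k + 1, hk⟩ := Fin.ext h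
    exact this ▸ i.2)
  simp only [groupLabel, wordLabel, gridWord_of_ne z z' y hi]

/-- Every cut separates some party `k + 1` from all the parties `0, …, k`. -/
theorem exists_separated_party {A : Finset (Fin L)} (hA : A.Nonempty) (hA' : Aᶜ.Nonempty) :
    ∃ (k : ℕ) (hk : k + 1 < L),
      (⟨k + 1, hk⟩ ∈ A ∧ ∀ i : Fin L, i.val ≤ k → i ∉ A) ∨
      (⟨k + 1, hk⟩ ∉ A ∧ ∀ i : Fin L, i.val ≤ k → i ∈ A) := by
  obtain ⟨a, ha⟩ := hA
  obtain ⟨b, hb⟩ := hA'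
  rw [Finset.mem_compl] at hb
  have hL : 0 < L := a.pos
  -- The least party on the other side of the cut from party `0` is the required `k + 1`.
  have hex : ∃ m, ∃ h : m < L, ¬ (⟨m, h⟩ ∈ A ↔ (⟨0, hL⟩ : Fin L) ∈ A) := by
    by_cases h0 : (⟨0, hL⟩ : Fin L) ∈ A
    · exact ⟨b, b.2, by simp [h0, hb]⟩
    · exact ⟨a, a.2, by simp [h0, ha]⟩
  classical
  obtain ⟨hm, hne⟩ := Nat.find_spec hex
  have hmin (i : Fin L) (hi : i.val < Nat.find hex) : i ∈ A ↔ (⟨0, hL⟩ : Fin L) ∈ A := by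
    have := Nat.find_min hex hi
    push Not at this
    simpa using this i.2
  generalize Nat.find hex = m at *
  rcases m with _ | k
  · exact absurd Iff.rfl hne
  · refine ⟨k, hm, ?_⟩
    by_cases h0 : (⟨0, hL⟩ : Fin L) ∈ A
    · exact Or.inr ⟨by simpa [h0] using hne, fun i hi => (hmin i (by omega)).2 h0⟩
    · exact Or.inl ⟨by simpa [h0] using hne, fun i hi e => h0 ((hmin i (by omega)).1 e)⟩

theorem genuinelyNonlocal_domino {κ : Type} [DecidableEq κ] [Fintype κ]
    (e : DominoIndex L × Bool ≃ κ) :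
    GenuinelyNonlocal fun k =>
      (WithLp.toLp 2 (dominoState (domino hd) (e.symm k)) : StateSpace d) := by
  intro A hA hA'
  obtain ⟨k, hk, h⟩ := exists_separated_party hA hA'
  have hg : (fun j : Fin 4 × Bool => e (pinwheelDomino hk j.1, j.2)).Injective :=
    e.injective.comp ((pinwheelDomino_injective hk).prodMap Function.injective_id)
  have hcut (t : Fin 4) (b : Bool) : Equiv.piEquivPiSubtypeProd (fun i => i ∈ A)
      (fun i => Fin (d i)) (domino hd (pinwheelDomino hk t) b) =
      (groupLabel hd (· ∈ A) (gridWord k (pinwheel t b).1 (pinwheel t b).2),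
        groupLabel hd (· ∉ A) (gridWord k (pinwheel t b).1 (pinwheel t b).2)) := by
    rw [domino_pinwheelDomino]
    rfl
  rcases h with ⟨hkA, hlt⟩ | ⟨hkA, hlt⟩
  -- The group `A` sees only the row and its complement only the column; `0` fills the coordinate
  -- that each does not see.
  · have hcut' (t : Fin 4) (b : Bool) := (hcut t b).trans (congrArg₂ Prod.mk
      (groupLabel_eq_row hd hlt _ _ 0)
      (groupLabel_eq_column hd hk (p := (· ∉ A)) (not_not.2 hkA) _ 0 _))
    refine not_locallyDistinguishable_of_pinwheel
      (groupLabel_row_injective hd (p := (· ∈ A)) hk hkA 0)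
      (groupLabel_column_injective hd hk hlt 0) hg fun j => ?_
    beta_reduce
    rw [Equiv.symm_apply_apply, acrossCut_dominoState]
    simp only [dominoState, hcut', Prod.map]
  -- Now `A` sees the columns, which calls for the transposed pinwheel.
  · have hcut' (t : Fin 4) (b : Bool) := (hcut t b).trans (congrArg₂ Prod.mk
      (groupLabel_eq_column hd hk (p := (· ∈ A)) hkA _ 0 _)
      (groupLabel_eq_row hd (p := (· ∉ A)) (fun i hi => not_not.2 (hlt i hi)) _ _ 0))
    refine not_locallyDistinguishable_of_pinwheel_swap
      (groupLabel_column_injective hd (p := (· ∈ A)) hk hlt 0)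
      (groupLabel_row_injective hd hk hkA 0) hg fun j => ?_
    beta_reduce
    rw [Equiv.symm_apply_apply, acrossCut_dominoState]
    simp only [dominoState, hcut', Prod.map, Prod.swap]

end Parties

end GenuineNonlocality

theorem theorem2 (L : ℕ) (hL : 3 ≤ L) (d : Fin L → ℕ) (hd : ∀ i, 3 ≤ d i) :
    ∃ (n : ℕ) (ψ : Fin n → GenuineNonlocality.StateSpace d),
      Orthonormal ℂ ψ ∧
      (∀ k, GenuineNonlocality.IsFullyProduct (ψ k)) ∧
      GenuineNonlocality.GenuinelyNonlocal ψ := by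
  let e := Fintype.equivFin (GenuineNonlocality.DominoIndex L × Bool)
  exact ⟨_, fun k => WithLp.toLp 2
      (GenuineNonlocality.dominoState (GenuineNonlocality.domino hd) (e.symm k)),
    (GenuineNonlocality.orthonormal_dominoState (GenuineNonlocality.domino_injective hd)).comp
      _ e.symm.injective,
    fun k => GenuineNonlocality.isFullyProduct_domino hd _,
    GenuineNonlocality.genuinelyNonlocal_domino hd e⟩
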